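/- All graphs are finite, simple, undirected and nonempty, and a host graph on $n$ vertices has vertex set $\{1,\dots,n\}$. Let $\mathrm{FO}$ be the first-order logic of graphs, whose atomic formulas are $x=y$ and adjacency of $x$ and $y$, and let $\mathrm{FO}[\mathrm{Arb}]$ be its extension by a symbol for every relation $R\subseteq\mathbb{Z}^r$, $r\ge1$, interpreted on $\{1,\dots,n\}$ by restriction. The variable width of a sentence is the number of different variables that occur in it (a variable may be quantified repeatedly and is counted once). Let $F$ be a connected graph. Let $W_{\mathrm{Arb}}(F)$ be the minimum variable width of an $\mathrm{FO}[\mathrm{Arb}]$ sentence $\Phi$ such that, for every graph $G$, $G\models\Phi$ if and only if $G$ contains a (not necessarily induced) subgraph isomorphic to $F$. Let $W_{\mathrm{tw}}(F)$ be the minimum variable width of an $\mathrm{FO}$ sentence $\Phi$ for which there is a $k$ such that the same equivalence holds for every connected graph $G$ of treewidth at least $k$. Then both minima exist (are taken over nonempty sets), and $$W_{\mathrm{Arb}}(F)\le W_{\mathrm{tw}}(F)+3 .$$ -/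

import Mathlib

namespace SubgraphLogic

/-- A numerical relation, of some arity `k + 1 ≥ 1`, over the integers. As the universes of the
structures are the sets `{1, …, n}`, only its restriction to natural numbers matters. -/
structure NumRel where
  arity : ℕ
  rel : Set (Fin (arity + 1) → ℕ)

/-- Formulas of the first-order logic of graphs `FO[N]` over a set `N` of numerical relations:
there are symbols for adjacency, for equality and for each relation in `N`. The variables are
`x₀, x₁, x₂, …`, named by natural numbers, and a variable may be quantified repeatedly.
The other connectives and the universal quantifier are abbreviations as usual
and need no further variables. -/
inductive Formula (N : Set NumRel) : Type
  | eq (x y : ℕ) : Formula N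
  | adj (x y : ℕ) : Formula N
  | num (R : NumRel) (hR : R ∈ N) (x : Fin (R.arity + 1) → ℕ) : Formula N
  | neg (φ : Formula N) : Formula N
  | and (φ ψ : Formula N) : Formula N
  | ex (x : ℕ) (φ : Formula N) : Formula N

namespace Formula

variable {N : Set NumRel}

/-- The set of all variables used in a formula (free or bound). -/
def vars : Formula N → Finset ℕ
  | eq x y => {x, y}
  | adj x y => {x, y}
  | num _ _ x => Finset.univ.image x
  | neg φ => φ.vars
  | and φ ψ => φ.vars ∪ ψ.vars
  | ex x φ => insert x φ.vars

/-- The set of free variables of a formula. -/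
def freeVars : Formula N → Finset ℕ
  | eq x y => {x, y}
  | adj x y => {x, y}
  | num _ _ x => Finset.univ.image x
  | neg φ => φ.freeVars
  | and φ ψ => φ.freeVars ∪ ψ.freeVars
  | ex x φ => φ.freeVars.erase x

/-- A sentence is a formula without free variables. -/
def IsSentence (φ : Formula N) : Prop := φ.freeVars = ∅

/-- The variable width: the number of different variables used to build the formula. -/
def width (φ : Formula N) : ℕ := φ.vars.card

/-- Satisfaction in an `n`-vertex graph under an assignment of vertices to the variables.
The vertex set is `{1, …, n}`: the element `i` of `Fin n` stands for the integer `i + 1`. -/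
def Holds {n : ℕ} (G : SimpleGraph (Fin n)) : Formula N → (ℕ → Fin n) → Prop
  | eq x y, v => v x = v y
  | adj x y, v => G.Adj (v x) (v y)
  | num R _ x, v => (fun i => (v (x i) : ℕ) + 1) ∈ R.rel
  | neg φ, v => ¬ Holds G φ v
  | and φ ψ, v => Holds G φ v ∧ Holds G ψ v
  | ex x φ, v => ∃ a : Fin n, Holds G φ (Function.update v x a)

/-- `G ⊨ φ`. For a sentence `φ` the assignment is irrelevant (if `G` has a vertex). -/
def Models {n : ℕ} (G : SimpleGraph (Fin n)) (φ : Formula N) : Prop :=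
  ∀ v : ℕ → Fin n, Holds G φ v

end Formula

/-- A tree decomposition of `G`, with a finite tree `T` and a bag of vertices at each node of
`T`. -/
structure TreeDecomposition {V : Type*} (G : SimpleGraph V) where
  size : ℕ
  T : SimpleGraph (Fin size)
  isTree : T.IsTree
  bag : Fin size → Finset V
  vertex_mem : ∀ v : V, ∃ t, v ∈ bag t
  edge_mem : ∀ u v : V, G.Adj u v → ∃ t, u ∈ bag t ∧ v ∈ bag t
  connected : ∀ v : V, (T.induce {t | v ∈ bag t}).Connected

/-- The treewidth of a finite nonempty graph: the least `w` such that `G` has a tree decomposition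
in which every bag has at most `w + 1` vertices. -/
noncomputable def treewidth {V : Type*} (G : SimpleGraph V) : ℕ :=
  sInf {w : ℕ | ∃ D : TreeDecomposition G, ∀ t, (D.bag t).card ≤ w + 1}

/-- The sentence `Φ` defines, among the nonempty finite graphs in `C`, the class of graphs that
contain a (not necessarily induced) subgraph isomorphic to `F`. -/
def DefinesSubgraphOn {V : Type*} (F : SimpleGraph V) {N : Set NumRel}
    (C : ∀ n : ℕ, Set (SimpleGraph (Fin n))) (Φ : Formula N) : Prop :=
  Φ.IsSentence ∧ ∀ n : ℕ, 0 < n → ∀ G ∈ C n, (Φ.Models G ↔ F.IsContained G)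

/-- The minimum variable width of a formula in a set (`⊤` if the set is empty). -/
noncomputable def minWidth {N : Set NumRel} (S : Set (Formula N)) : ℕ∞ :=
  ⨅ Φ ∈ S, (Φ.width : ℕ∞)

/-- `W_Arb(F)`: the minimum variable width of a sentence of `FO[Arb]`, with all numerical
relations available, that defines the existence of an `F` subgraph on all graphs. -/
noncomputable def WArb {V : Type*} (F : SimpleGraph V) : ℕ∞ :=
  minWidth {Φ : Formula (Set.univ : Set NumRel) | DefinesSubgraphOn F (fun _ => Set.univ) Φ}

/-- `W_tw(F)`: the minimum variable width of a sentence of pure `FO`, without numerical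
relations, that for some `k` defines the existence of an `F` subgraph on all connected graphs of
treewidth at least `k`. -/
noncomputable def Wtw {V : Type*} (F : SimpleGraph V) : ℕ∞ :=
  minWidth {Φ : Formula (∅ : Set NumRel) |
    ∃ k : ℕ, DefinesSubgraphOn F (fun _ => {G | G.Connected ∧ k ≤ treewidth G}) Φ}

end SubgraphLogic

/-! Both widths are compared with a structural quantity: the number of vertices left after `F` is
pruned by repeatedly deleting vertices of degree at most one. Lower bound: let a pure sentence of
width `w` define `F` on connected graphs of treewidth at least `k`. Take `k + 1` long paths,
pairwise joined by an edge; this graph is connected, has treewidth at least `k`, and contains no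
short cycle. Attach a clique at a corner `q`. With `w` variables a clique of `w` new vertices looks
like one large enough to hold `F` (`holds_iff_of_matching`), so `F` already embeds with `w` new
vertices. A small subgraph of minimum degree two cannot use the paths, hence lies in the clique
together with `q`, and `F` prunes to at most `w + 1` vertices (`prunable_of_definesSubgraphOn`).
Upper bound: a homomorphism from such an `F` can be expressed with `w + 1` variables, because pruned
vertices are recovered by requantifying. Injectivity comes from colour coding: `Arb` lets two
further variables select a colouring of the host, and vertices of `F` are required to receive
distinct colours (`Prunable.exists_definesSubgraphOn`). The total is `w + 3`. -/

namespace SubgraphLogic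

/-! ### Subtrees of a tree and lower bounds for treewidth -/

/-- A set of vertices that contains every path between two of its vertices. -/
def PathConvex {V : Type*} (T : SimpleGraph V) (A : Set V) : Prop :=
  ∀ ⦃x y : V⦄, x ∈ A → y ∈ A → ∀ p : T.Walk x y, p.IsPath → ∀ z ∈ p.support, z ∈ A

theorem mem_support_map_induce {V : Type*} {T : SimpleGraph V} {A : Set V} {x y : A}
    (w : (T.induce A).Walk x y) (z : V) :
    z ∈ (w.map (SimpleGraph.Embedding.induce A).toHom).support ↔
      ∃ h : z ∈ A, ⟨z, h⟩ ∈ w.support := by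
  rw [SimpleGraph.Walk.support_map, List.mem_map]
  exact ⟨fun ⟨u, hu, huz⟩ => huz ▸ ⟨u.2, hu⟩, fun ⟨h, hz⟩ => ⟨_, hz, rfl⟩⟩

/-- Paths in a forest are unique, so the given path is the one that runs inside `A`. -/
theorem PathConvex.of_preconnected {V : Type*} {T : SimpleGraph V} (hT : T.IsAcyclic) {A : Set V}
    (hA : (T.induce A).Preconnected) : PathConvex T A := by
  classical
  intro x y hx hy p hp z hz
  obtain ⟨w⟩ := hA ⟨x, hx⟩ ⟨y, hy⟩
  have hq : (w.bypass.map (SimpleGraph.Embedding.induce A).toHom).IsPath :=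
    w.bypass_isPath.map Subtype.val_injective
  have h : p = w.bypass.map (SimpleGraph.Embedding.induce A).toHom :=
    congrArg Subtype.val ((hT.subsingleton_path x y).elim ⟨p, hp⟩ ⟨_, hq⟩)
  subst h
  exact ((mem_support_map_induce w.bypass z).1 hz).1

/-- Helly's theorem for subtrees of a finite tree. -/
theorem exists_mem_of_pairwise_inter {ι : Type*} (k : ℕ) : ∀ {V : Type*} [Fintype V]
    (T : SimpleGraph V), Fintype.card V = k → T.IsTree → ∀ A : ι → Set V,
    (∀ i, PathConvex T (A i)) → (∀ i j, (A i ∩ A j).Nonempty) → ∃ t, ∀ i, t ∈ A i := by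
  induction k with
  | zero =>
    intro V _ T hk hT
    have := Fintype.card_eq_zero_iff.1 hk
    exact (this.false hT.connected.nonempty.some).elim
  | succ k ih =>
    intro V _ T hk hT A hA hAA
    classical
    rcases subsingleton_or_nontrivial V with hV | hV
    · refine ⟨hT.connected.nonempty.some, fun i => ?_⟩
      obtain ⟨x, hx, -⟩ := hAA i i
      rwa [Subsingleton.elim (Nonempty.some _) x]
    obtain ⟨v, hv⟩ := hT.exists_vert_degree_one_of_nontrivial
    by_cases hone : ∃ i, A i ⊆ {v}
    · obtain ⟨i, hi⟩ := hone
      refine ⟨v, fun j => ?_⟩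
      obtain ⟨x, hx, hx'⟩ := hAA i j
      rwa [← show x = v from hi hx]
    push Not at hone
    obtain ⟨u, hu, huniq⟩ := SimpleGraph.degree_eq_one_iff_existsUnique_adj.1 hv
    -- A path from the leaf `v` to another point of `A i` starts through its only neighbour `u`.
    -- Hence `u` can replace `v` in every intersection once the leaf is removed.
    have hleaf : ∀ i, v ∈ A i → u ∈ A i := by
      intro i hi
      obtain ⟨y, hy, hyv⟩ := Set.not_subset.1 (hone i)
      obtain ⟨p, hp, -⟩ := hT.existsUnique_path v y
      have hnil : ¬ p.Nil := fun h => hyv h.eq.symm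
      have hadj := p.adj_snd hnil
      rw [← huniq _ hadj]
      exact hA i hi hy p hp _ (p.getVert_mem_support 1)
    have hT' : (T.induce {v}ᶜ).IsTree :=
      ⟨hT.connected.induce_compl_singleton_of_degree_eq_one hv, hT.isAcyclic.induce _⟩
    obtain ⟨t, ht⟩ := ih (T.induce ({v}ᶜ : Set V)) (by
        rw [Fintype.card_compl_set, hk]; simp) hT'
      (fun i => Subtype.val ⁻¹' A i) (fun i x y hx hy p hp z hz => by
        refine hA i hx hy (p.map (SimpleGraph.Embedding.induce _).toHom)
          (hp.map Subtype.val_injective) _ ?_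
        exact (mem_support_map_induce p _).2 ⟨z.2, hz⟩) (fun i j => by
        obtain ⟨x, hx, hx'⟩ := hAA i j
        by_cases hxv : x = v
        · subst hxv
          exact ⟨⟨u, hu.ne'⟩, hleaf i hx, hleaf j hx'⟩
        · exact ⟨⟨x, hxv⟩, hx, hx'⟩)
    exact ⟨t, ht⟩

/-- The nodes whose bags meet a path form a connected set. -/
theorem TreeDecomposition.connected_of_chain {V : Type*} {G : SimpleGraph V}
    (D : TreeDecomposition G) (r : ℕ → V) (k : ℕ) (hr : ∀ a < k, G.Adj (r a) (r (a + 1))) :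
    (D.T.induce {t | ∃ a ≤ k, r a ∈ D.bag t}).Connected := by
  induction k with
  | zero =>
    have h : {t | ∃ a ≤ 0, r a ∈ D.bag t} = {t | r 0 ∈ D.bag t} := by simp
    exact h ▸ D.connected (r 0)
  | succ k ih =>
    have h1 := ih fun a ha => hr a (by lia)
    have h : {t | ∃ a ≤ k + 1, r a ∈ D.bag t} =
        {t | ∃ a ≤ k, r a ∈ D.bag t} ∪ {t | r (k + 1) ∈ D.bag t} := by
      ext t
      simp [Nat.le_succ_iff_eq_or_le, or_and_right, exists_or, or_comm]
    rw [h]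
    obtain ⟨t, ht, ht'⟩ := D.edge_mem _ _ (hr k (by lia))
    exact SimpleGraph.induce_union_connected h1.preconnected (D.connected _).preconnected
      ⟨t, ⟨k, le_rfl, ht⟩, ht'⟩

/-- If `m` disjoint paths are pairwise joined by edges, then some bag has at least `m`
vertices. -/
theorem TreeDecomposition.exists_card_le_bag {V : Type*} {G : SimpleGraph V}
    (D : TreeDecomposition G) {m k : ℕ} (r : Fin m → ℕ → V)
    (hr : ∀ i, ∀ a < k, G.Adj (r i a) (r i (a + 1)))
    (hinj : ∀ i j, ∀ a ≤ k, ∀ b ≤ k, r i a = r j b → i = j)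
    (hcross : ∀ i j, i ≠ j → ∃ a ≤ k, ∃ b ≤ k, G.Adj (r i a) (r j b)) :
    ∃ t, m ≤ (D.bag t).card := by
  classical
  have hconn := fun i => D.connected_of_chain (r i) k (hr i)
  obtain ⟨t, ht⟩ := exists_mem_of_pairwise_inter _ D.T rfl D.isTree
    (fun i => {t | ∃ a ≤ k, r i a ∈ D.bag t})
    (fun i => PathConvex.of_preconnected D.isTree.isAcyclic (hconn i).preconnected)
    (fun i j => by
      by_cases hij : i = j
      · subst hij
        obtain ⟨t, ht⟩ := D.vertex_mem (r i 0)
        exact ⟨t, ⟨0, by lia, ht⟩, ⟨0, by lia, ht⟩⟩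
      · obtain ⟨a, ha, b, hb, hab⟩ := hcross i j hij
        obtain ⟨t, ht, ht'⟩ := D.edge_mem _ _ hab
        exact ⟨t, ⟨a, ha, ht⟩, ⟨b, hb, ht'⟩⟩)
  choose a ha hat using ht
  refine ⟨t, ?_⟩
  have := Finset.card_le_card_of_injOn (s := Finset.univ) (t := D.bag t) (fun i => r i (a i))
    (fun i _ => hat i) (fun i _ j _ h => hinj i j _ (ha i) _ (ha j) h)
  simpa using this

/-- Every finite graph has the tree decomposition with a single bag. -/
def trivialTreeDecomposition {V : Type*} [Fintype V] (G : SimpleGraph V) :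
    TreeDecomposition G where
  size := 1
  T := ⊥
  isTree := SimpleGraph.IsTree.of_subsingleton
  bag _ := Finset.univ
  vertex_mem _ := ⟨0, Finset.mem_univ _⟩
  edge_mem _ _ _ := ⟨0, Finset.mem_univ _, Finset.mem_univ _⟩
  connected v := by
    have : Nonempty ({t | v ∈ (Finset.univ : Finset V)} : Set (Fin 1)) := ⟨⟨0, by simp⟩⟩
    exact SimpleGraph.IsTree.of_subsingleton.connected

theorem le_treewidth {V : Type*} [Fintype V] (G : SimpleGraph V) (k : ℕ)
    (h : ∀ D : TreeDecomposition G, ∃ t, k + 1 ≤ (D.bag t).card) : k ≤ treewidth G := by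
  -- The infimum must be attained: on an empty set `sInf` would be the default value 0.
  have hne : {w : ℕ | ∃ D : TreeDecomposition G, ∀ t, (D.bag t).card ≤ w + 1}.Nonempty :=
    ⟨Fintype.card V, trivialTreeDecomposition G, fun t => by
      have := Finset.card_le_univ ((trivialTreeDecomposition G).bag t)
      lia⟩
  obtain ⟨D, hD⟩ := Nat.sInf_mem hne
  obtain ⟨t, ht⟩ := h D
  have := hD t
  unfold treewidth
  lia

/-! ### Closure properties of definable queries -/

/-- Properties of a graph together with an assignment of vertices to the variables. -/
abbrev Query := ∀ n : ℕ, SimpleGraph (Fin n) → (ℕ → Fin n) → Prop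

/-- The query `P` is expressible by a formula with variables in `X` and free variables in `Y`. -/
def Definable (N : Set NumRel) (X Y : Finset ℕ) (P : Query) : Prop :=
  ∃ φ : Formula N, φ.vars ⊆ X ∧ φ.freeVars ⊆ Y ∧ ∀ n G v, φ.Holds G v ↔ P n G v

namespace Definable

variable {N : Set NumRel} {X Y : Finset ℕ} {P Q : Query}

theorem congr (hP : Definable N X Y P) (h : ∀ n G v, P n G v ↔ Q n G v) : Definable N X Y Q := by
  obtain ⟨φ, h1, h2, h3⟩ := hP
  exact ⟨φ, h1, h2, fun n G v => (h3 n G v).trans (h n G v)⟩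

theorem mono {Y' : Finset ℕ} (hP : Definable N X Y P) (h : Y ⊆ Y') : Definable N X Y' P := by
  obtain ⟨φ, h1, h2, h3⟩ := hP
  exact ⟨φ, h1, h2.trans h, h3⟩

theorem eq {x y : ℕ} (hx : x ∈ X) (hy : y ∈ X) :
    Definable N X {x, y} fun _ _ v => v x = v y :=
  ⟨.eq x y, by simp [Formula.vars, Finset.insert_subset_iff, hx, hy], subset_rfl,
    fun _ _ _ => Iff.rfl⟩

theorem adj {x y : ℕ} (hx : x ∈ X) (hy : y ∈ X) :
    Definable N X {x, y} fun _ G v => G.Adj (v x) (v y) :=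
  ⟨.adj x y, by simp [Formula.vars, Finset.insert_subset_iff, hx, hy], subset_rfl,
    fun _ _ _ => Iff.rfl⟩

theorem num (R : NumRel) (hR : R ∈ N) (x : Fin (R.arity + 1) → ℕ) (hX : ∀ i, x i ∈ X) :
    Definable N X (Finset.univ.image x) fun _ _ v => (fun i => (v (x i) : ℕ) + 1) ∈ R.rel :=
  ⟨.num R hR x, by simpa [Formula.vars, Finset.subset_iff] using hX, subset_rfl,
    fun _ _ _ => Iff.rfl⟩

theorem not (hP : Definable N X Y P) : Definable N X Y fun n G v => ¬ P n G v := by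
  obtain ⟨φ, h1, h2, h3⟩ := hP
  exact ⟨.neg φ, h1, h2, fun n G v => not_congr (h3 n G v)⟩

theorem and (hP : Definable N X Y P) (hQ : Definable N X Y Q) :
    Definable N X Y fun n G v => P n G v ∧ Q n G v := by
  obtain ⟨φ, h1, h2, h3⟩ := hP
  obtain ⟨ψ, h1', h2', h3'⟩ := hQ
  exact ⟨.and φ ψ, Finset.union_subset h1 h1', Finset.union_subset h2 h2',
    fun n G v => and_congr (h3 n G v) (h3' n G v)⟩

theorem ex (hP : Definable N X Y P) {x : ℕ} (hx : x ∈ X) :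
    Definable N X (Y.erase x) fun n G v => ∃ a, P n G (Function.update v x a) := by
  obtain ⟨φ, h1, h2, h3⟩ := hP
  exact ⟨.ex x φ, Finset.insert_subset hx h1, Finset.erase_subset_erase _ h2,
    fun n G v => exists_congr fun a => h3 n G _⟩

theorem const (hX : X.Nonempty) (p : Prop) : Definable N X Y fun _ _ _ => p := by
  obtain ⟨x, hx⟩ := hX
  -- Truth is written as `∃ x, x = x`; the assignment itself shows that the universe is nonempty.
  have h : Definable N X Y fun _ _ _ => True :=
    (((eq (N := N) hx hx).ex hx).congr fun _ _ v => by simpa using ⟨v x⟩).mono (by simp)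
  by_cases hp : p
  · simpa [hp] using h
  · simpa [hp] using h.not

theorem all {ι : Type*} (hX : X.Nonempty) (s : Finset ι) {P : ι → Query}
    (hP : ∀ i ∈ s, Definable N X Y (P i)) :
    Definable N X Y fun n G v => ∀ i ∈ s, P i n G v := by
  classical
  induction s using Finset.induction_on with
  | empty => simpa using const hX True
  | insert i s hi ih =>
    simp only [Finset.forall_mem_insert] at hP ⊢
    exact hP.1.and (ih hP.2)

theorem any {ι : Type*} (hX : X.Nonempty) (s : Finset ι) {P : ι → Query}
    (hP : ∀ i ∈ s, Definable N X Y (P i)) :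
    Definable N X Y fun n G v => ∃ i ∈ s, P i n G v :=
  (all hX s fun i hi => (hP i hi).not).not.congr fun _ _ _ => by push Not; rfl

/-- The condition `p` does not depend on the host, so it is decided while the formula is being
written. Conditions such as adjacency in `F` enter this way. -/
theorem imp_const (hX : X.Nonempty) {p : Prop} (hP : p → Definable N X Y P) :
    Definable N X Y fun n G v => p → P n G v := by
  by_cases hp : p
  · simpa [hp] using hP hp
  · simpa [hp] using const hX True

theorem exs (hP : Definable N X Y P) {Z : Finset ℕ} (hZ : Z ⊆ X) :
    Definable N X (Y \ Z) fun n G v => ∃ v' : ℕ → Fin n, (∀ x ∉ Z, v' x = v x) ∧ P n G v' := by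
  induction Z using Finset.induction_on with
  | empty =>
    refine (hP.mono (by simp)).congr fun n G v => ⟨fun h => ⟨v, by simp, h⟩, ?_⟩
    rintro ⟨v', h, h'⟩
    rwa [show v = v' from funext fun x => (h x (by simp)).symm]
  | insert z Z hz ih =>
    rw [Finset.insert_subset_iff] at hZ
    refine (((ih hZ.2).ex hZ.1).mono (by
      intro x; simp only [Finset.mem_erase, Finset.mem_sdiff, Finset.mem_insert]; tauto)).congr
      fun n G v => ⟨?_, ?_⟩
    · rintro ⟨a, v', h, h'⟩
      refine ⟨v', fun x hx => ?_, h'⟩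
      simp only [Finset.mem_insert, not_or] at hx
      rw [h x hx.2, Function.update_of_ne hx.1]
    · rintro ⟨v', h, h'⟩
      refine ⟨v' z, v', fun x hx => ?_, h'⟩
      by_cases hxz : x = z
      · subst hxz; simp
      · rw [Function.update_of_ne hxz]
        exact h x (by simp [hx, hxz])

end Definable

/-! ### Homomorphisms from prunable graphs with `w + 1` reusable variables -/

/-- `S` can be brought to at most `w + 1` vertices by deleting vertices of degree at most one. -/
inductive Prunable {V : Type*} [DecidableEq V] (F : SimpleGraph V) (w : ℕ) : Finset V → Prop
  | small (S : Finset V) : S.card ≤ w + 1 → Prunable F w S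
  | prune (S : Finset V) (v u : V) : v ∈ S → (∀ x ∈ S, F.Adj v x → x = u) →
      Prunable F w (S.erase v) → Prunable F w S

/-- `h` is a homomorphism on `S` that respects the vertex constraints `P`. -/
def IsHomOn {V A : Type*} (F : SimpleGraph V) (G : SimpleGraph A) (S : Finset V)
    (P : V → A → Prop) (h : V → A) : Prop :=
  (∀ u ∈ S, P u (h u)) ∧ ∀ u ∈ S, ∀ u' ∈ S, F.Adj u u' → G.Adj (h u) (h u')

/-- Constraints on a vertex in terms of two further vertices. -/
abbrev VertexQuery := ∀ n : ℕ, SimpleGraph (Fin n) → Fin n → Fin n → Fin n → Prop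

/-- Each vertex of `S` gets its own variable among `0, …, w`; the variables `w + 1` and `w + 2` are
kept for the parameters. -/
theorem definable_isHomOn_of_card_le {N : Set NumRel} {V : Type*} [DecidableEq V]
    (F : SimpleGraph V) {w : ℕ} {S : Finset V} (hS : S.card ≤ w + 1) (P : V → VertexQuery)
    (hP : ∀ u, ∀ x < w + 1, Definable N (Finset.range (w + 3)) {x, w + 1, w + 2}
      fun n G v => P u n G (v (w + 1)) (v (w + 2)) (v x)) :
    Definable N (Finset.range (w + 3)) {w + 1, w + 2} fun n G v =>
      ∃ h, IsHomOn F G S (fun u => P u n G (v (w + 1)) (v (w + 2))) h := by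
  have hX : (Finset.range (w + 3)).Nonempty := ⟨0, by simp⟩
  let f : V → ℕ := fun u => if h : u ∈ S then (S.equivFin ⟨u, h⟩ : ℕ) else 0
  have hf : ∀ u, f u < w + 1 := by
    intro u
    simp only [f]
    split_ifs with h
    · have := (S.equivFin ⟨u, h⟩).2
      lia
    · lia
  have hfinj : ∀ u ∈ S, ∀ u' ∈ S, f u = f u' → u = u' := by
    intro u hu u' hu' h
    simp only [f, hu, hu', dif_pos] at h
    simpa using S.equivFin.injective (Fin.ext h)
  have hbody : Definable N (Finset.range (w + 3)) (Finset.range (w + 3)) fun n G v =>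
      IsHomOn F G S (fun u => P u n G (v (w + 1)) (v (w + 2))) (fun u => v (f u)) := by
    refine .and (.all hX S fun u _ => (hP u _ (hf u)).mono ?_)
      (.all hX S fun u _ => .all hX S fun u' _ => .imp_const hX fun _ =>
        (Definable.adj ?_ ?_).mono ?_)
    · have := hf u
      simp only [Finset.insert_subset_iff, Finset.singleton_subset_iff, Finset.mem_range]
      lia
    · have := hf u
      simp only [Finset.mem_range]
      lia
    · have := hf u'
      simp only [Finset.mem_range]
      lia
    · have := hf u
      have := hf u'
      simp only [Finset.insert_subset_iff, Finset.singleton_subset_iff, Finset.mem_range]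
      lia
  refine ((hbody.exs (Z := Finset.range (w + 1)) (by simp)).mono ?_).congr fun n G v => ⟨?_, ?_⟩
  · intro x
    simp only [Finset.mem_sdiff, Finset.mem_range, Finset.mem_insert, Finset.mem_singleton]
    lia
  · rintro ⟨v', h, h'⟩
    rw [h _ (by simp), h _ (by simp)] at h'
    exact ⟨_, h'⟩
  · rintro ⟨h, h1, h2⟩
    let v' : ℕ → Fin n := fun x =>
      if hx : ∃ u ∈ S, f u = x then h hx.choose else v x
    have hv' : ∀ u ∈ S, v' (f u) = h u := by
      intro u hu
      have hx : ∃ u' ∈ S, f u' = f u := ⟨u, hu, rfl⟩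
      simp only [v', dif_pos hx]
      rw [hfinj _ hx.choose_spec.1 _ hu hx.choose_spec.2]
    have hv : ∀ x ∉ Finset.range (w + 1), v' x = v x := by
      intro x hx
      have hx' : ¬ ∃ u ∈ S, f u = x := by
        rintro ⟨u, -, rfl⟩
        exact hx (Finset.mem_range.2 (hf u))
      simp only [v', dif_neg hx']
    refine ⟨v', hv, fun u hu => ?_, fun u hu u' hu' ha => ?_⟩
    · beta_reduce
      rw [hv' u hu, hv _ (by simp), hv _ (by simp)]
      exact h1 u hu
    · beta_reduce
      rw [hv' u hu, hv' u' hu']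
      exact h2 u hu u' hu' ha

/-- A pruned vertex `z` with neighbour `u` is absorbed into the constraint on `u`: its image must
have a neighbour that satisfies the constraint of `z`. The new constraint again concerns one vertex
and the two parameters, so no variable is added. -/
theorem definable_isHomOn {N : Set NumRel} {V : Type*} [DecidableEq V]
    (F : SimpleGraph V) {w : ℕ} (hw : 0 < w) {S : Finset V} (hS : Prunable F w S) :
    ∀ P : V → VertexQuery,
    (∀ u, ∀ x < w + 1, Definable N (Finset.range (w + 3)) {x, w + 1, w + 2}
      fun n G v => P u n G (v (w + 1)) (v (w + 2)) (v x)) →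
    Definable N (Finset.range (w + 3)) {w + 1, w + 2} fun n G v =>
      ∃ h, IsHomOn F G S (fun u => P u n G (v (w + 1)) (v (w + 2))) h := by
  induction hS with
  | small S hS => exact fun P hP => definable_isHomOn_of_card_le F hS P hP
  | prune S z u hz hu _ ih =>
    intro P hP
    by_cases hzu : u ∈ S ∧ F.Adj z u
    · have hne : u ≠ z := hzu.2.ne'
      refine (ih (fun t n G a b c => P t n G a b c ∧ (t = u → ∃ d, G.Adj c d ∧ P z n G a b d))
        fun t x hx => (hP t x hx).and (.imp_const ⟨0, by simp⟩ fun _ => ?_)).congr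
          fun n G v => ⟨?_, ?_⟩
      -- Any second vertex variable may be requantified, since the constraint depends only on `x`
      -- and the parameters. It exists because `0 < w`.
      · obtain ⟨y, hy, hyx⟩ : ∃ y < w + 1, y ≠ x :=
          ⟨if x = 0 then 1 else 0, by split_ifs <;> lia, by split_ifs <;> lia⟩
        have hd := ((Definable.adj (N := N) (X := Finset.range (w + 3)) (x := x) (y := y)
          (by simp; lia) (by simp; lia)).mono (Y' := {x, y, w + 1, w + 2}) (by
            simp)).and ((hP z y hy).mono
            (Y' := {x, y, w + 1, w + 2}) (by simp))
        refine ((hd.ex (x := y) (by simp; lia)).mono ?_).congr fun n G v => ?_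
        · intro t
          simp only [Finset.mem_erase, Finset.mem_insert, Finset.mem_singleton]
          tauto
        · refine exists_congr fun d => ?_
          rw [Function.update_self, Function.update_of_ne hyx.symm,
            Function.update_of_ne (by lia), Function.update_of_ne (by lia)]
      · rintro ⟨h, h1, h2⟩
        obtain ⟨d, hd, hd'⟩ := (h1 u (by simp [hzu.1, hne])).2 rfl
        refine ⟨Function.update h z d, fun t ht => ?_, fun t ht t' ht' ha => ?_⟩
        · by_cases htz : t = z
          · subst htz; simpa using hd'
          · rw [Function.update_of_ne htz]
            exact (h1 t (by simp [ht, htz])).1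
        · by_cases htz : t = z
          · subst htz
            rw [hu t' ht' ha, Function.update_self, Function.update_of_ne hne]
            exact hd.symm
          · by_cases htz' : t' = z
            · subst htz'
              rw [hu t ht ha.symm, Function.update_self, Function.update_of_ne hne]
              exact hd
            · rw [Function.update_of_ne htz, Function.update_of_ne htz']
              exact h2 t (by simp [ht, htz]) t' (by simp [ht', htz']) ha
      · rintro ⟨h, h1, h2⟩
        refine ⟨h, fun t ht => ⟨h1 t (Finset.mem_of_mem_erase ht), ?_⟩, fun t ht t' ht' =>
          h2 t (Finset.mem_of_mem_erase ht) t' (Finset.mem_of_mem_erase ht')⟩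
        rintro rfl
        exact ⟨h z, h2 _ hzu.1 _ hz hzu.2.symm, h1 z hz⟩
    -- Here `z` is isolated in `S`, and its image is chosen independently of the others.
    · have hiso : ∀ x ∈ S, ¬ F.Adj z x := fun x hx ha => hzu (by
        obtain rfl := hu x hx ha
        exact ⟨hx, ha⟩)
      have hd : Definable N (Finset.range (w + 3)) {w + 1, w + 2}
          fun n G v => ∃ d, P z n G (v (w + 1)) (v (w + 2)) d := by
        refine (((hP z 0 (by lia)).ex (x := 0) (by simp)).mono ?_).congr fun n G v => ?_
        · intro t
          simp only [Finset.mem_erase, Finset.mem_insert, Finset.mem_singleton]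
          tauto
        · refine exists_congr fun d => ?_
          rw [Function.update_self, Function.update_of_ne (by lia),
            Function.update_of_ne (by lia)]
      refine ((ih P hP).and hd).congr fun n G v => ⟨?_, ?_⟩
      · rintro ⟨⟨h, h1, h2⟩, d, hd⟩
        refine ⟨Function.update h z d, fun t ht => ?_, fun t ht t' ht' ha => ?_⟩
        · by_cases htz : t = z
          · subst htz; simpa using hd
          · rw [Function.update_of_ne htz]
            exact h1 t (by simp [ht, htz])
        · have htz : t ≠ z := fun e => hiso t' ht' (e ▸ ha)
          have htz' : t' ≠ z := fun e => hiso t ht (e ▸ ha.symm)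
          rw [Function.update_of_ne htz, Function.update_of_ne htz']
          exact h2 t (by simp [ht, htz]) t' (by simp [ht', htz']) ha
      · rintro ⟨h, h1, h2⟩
        exact ⟨⟨h, fun t ht => h1 t (Finset.mem_of_mem_erase ht), fun t ht t' ht' =>
          h2 t (Finset.mem_of_mem_erase ht) t' (Finset.mem_of_mem_erase ht')⟩, h z, h1 z hz⟩

/-! ### Colour coding by two vertices of the host -/

/-- The first `K` bits of `x` at the positions at which `y` or `z` has the bit `1`. -/
noncomputable def bitColor (K y z x : ℕ) : Fin K → Bool :=
  fun j => x.testBit (Nat.nth (fun b => y.testBit b ∨ z.testBit b) j)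

/-- The number with bit set `B` may be `n` or more, so it is split: the top bit goes into one number
and the lower bits, with sum below that power of two, into the other. -/
theorem exists_testBit_or_iff_mem {n : ℕ} (hn : 0 < n) (B : Finset ℕ) (hB : ∀ b ∈ B, 2 ^ b < n) :
    ∃ y < n, ∃ z < n, ∀ b, (y.testBit b ∨ z.testBit b) ↔ b ∈ B := by
  rcases B.eq_empty_or_nonempty with rfl | hne
  · exact ⟨0, hn, 0, hn, by simp⟩
  let m := B.max' hne
  have hm : m ∈ B := B.max'_mem hne
  refine ⟨2 ^ m, hB m hm, Nat.ofBits (fun i : Fin m => decide ((i : ℕ) ∈ B)),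
    (Nat.ofBits_lt_two_pow _).trans (hB m hm), fun b => ?_⟩
  rw [Nat.testBit_two_pow]
  rcases lt_trichotomy b m with h | h | h
  · rw [Nat.testBit_ofBits_lt _ _ h]
    simp [h.ne']
  · simp [h, hm]
  · rw [Nat.testBit_ofBits_ge _ _ h.le]
    have : b ∉ B := fun hb => absurd (B.le_max' b hb) (not_le.2 h)
    simp [h.ne, this]

/-- The colourings `bitColor K y z` with `y, z < n` form a perfect hash family. -/
theorem exists_bitColor_injOn {n K : ℕ} (hn : 0 < n) (S : Finset ℕ) (hS : ∀ x ∈ S, x < n)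
    (hK : S.card * S.card ≤ K) :
    ∃ y < n, ∃ z < n, Set.InjOn (bitColor K y z) S := by
  classical
  -- Select one separating bit per pair. It is set in one of the two members, so its power of two is
  -- below `n`.
  have hex : ∀ p : ℕ × ℕ, ∃ b, p.1 ≠ p.2 → p.1.testBit b ≠ p.2.testBit b := by
    intro p
    by_cases h : p.1 = p.2
    · exact ⟨0, fun h' => absurd h h'⟩
    · obtain ⟨b, hb⟩ := Nat.exists_testBit_ne_of_ne h
      exact ⟨b, fun _ => hb⟩
  choose β hβ using hex
  obtain ⟨y, hy, z, hz, hB⟩ := exists_testBit_or_iff_mem hn (S.offDiag.image β) (by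
    intro b hb
    obtain ⟨p, hp, rfl⟩ := Finset.mem_image.1 hb
    obtain ⟨h1, h2, h3⟩ := Finset.mem_offDiag.1 hp
    have := hβ p h3
    cases h : p.1.testBit (β p) with
    | true => exact (Nat.ge_two_pow_of_testBit h).trans_lt (hS _ h1)
    | false =>
      rw [h] at this
      exact (Nat.ge_two_pow_of_testBit (by simpa using this.symm)).trans_lt (hS _ h2))
  refine ⟨y, hy, z, hz, fun x hx x' hx' h => ?_⟩
  by_contra hne
  have hb : β (x, x') ∈ S.offDiag.image β :=
    Finset.mem_image_of_mem β (Finset.mem_offDiag.2 ⟨hx, hx', hne⟩)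
  -- The rank of a selected position among all selected ones is below their number, which is at most
  -- `K`; so the colour records this bit.
  have hlt : Nat.count (fun b => y.testBit b ∨ z.testBit b) (β (x, x')) < K := by
    refine lt_of_lt_of_le ?_ hK
    refine lt_of_lt_of_le ?_ (Finset.card_image_le.trans (by
      rw [Finset.offDiag_card]; exact Nat.sub_le _ _) : (S.offDiag.image β).card ≤ _)
    rw [Nat.count_eq_card_filter_range]
    refine Finset.card_lt_card (Finset.ssubset_iff_of_subset (fun b h => ?_) |>.2
      ⟨_, hb, by simp⟩)
    exact (hB b).1 (Finset.mem_filter.1 h).2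
  have h' := congrFun h ⟨_, hlt⟩
  simp only [bitColor] at h'
  rw [Nat.nth_count (p := fun b => y.testBit b ∨ z.testBit b) ((hB _).2 hb)] at h'
  exact hβ (x, x') hne h'

theorem definable_bitColor {X : Finset ℕ} (K : ℕ) (c : Fin K → Bool) {x y z : ℕ} (hx : x ∈ X)
    (hy : y ∈ X) (hz : z ∈ X) :
    Definable Set.univ X {x, y, z} fun _ _ v => bitColor K (v y) (v z) (v x) = c := by
  -- Subtracting 1 undoes the shift from `Fin n` to `{1, …, n}`.
  refine ((Definable.num ⟨2, {t | bitColor K (t 0 - 1) (t 1 - 1) (t 2 - 1) = c}⟩ (Set.mem_univ _)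
    ![y, z, x] ?_).mono ?_).congr fun n G v => ?_
  · intro i
    fin_cases i <;> assumption
  · intro t
    simp only [Finset.mem_image, Finset.mem_univ, true_and]
    rintro ⟨i, rfl⟩
    fin_cases i <;> simp
  · simp

/-- A prunable graph can be found with `w + 1` variables for its vertices and two variables that
select a colouring of the host graph. -/
theorem Prunable.exists_definesSubgraphOn {V : Type*} [Fintype V] [DecidableEq V]
    {F : SimpleGraph V} {w : ℕ} (hw : 0 < w) (hF : Prunable F w Finset.univ) :
    ∃ Φ : Formula (Set.univ : Set NumRel),
      DefinesSubgraphOn F (fun _ => Set.univ) Φ ∧ Φ.width ≤ w + 3 := by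
  classical
  let K := Fintype.card V * Fintype.card V
  -- The sentence is a finite disjunction over injective prescriptions of colours; a homomorphism
  -- that obeys one of them is injective.
  let C : Finset (V → Fin K → Bool) := {c | Function.Injective c}
  have hc : ∀ c ∈ C, Definable Set.univ (Finset.range (w + 3)) {w + 1, w + 2} fun n G v =>
      ∃ h, IsHomOn F G Finset.univ
        (fun u x => bitColor K (v (w + 1)) (v (w + 2)) x = c u) h := fun c _ =>
    definable_isHomOn F hw hF (fun u n _ a b x => bitColor K a b x = c u) fun u x hx =>
      definable_bitColor K (c u) (by simp; lia) (by simp) (by simp)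
  obtain ⟨Φ, h1, h2, h3⟩ := (Definable.any ⟨0, by simp⟩ C hc).exs
    (Z := {w + 1, w + 2}) (by simp [Finset.insert_subset_iff])
  refine ⟨Φ, ⟨by simpa [Formula.IsSentence] using h2, fun n hn G _ => ⟨fun h => ?_, fun h v => ?_⟩⟩,
    by simpa [Formula.width] using Finset.card_le_card h1⟩
  · obtain ⟨v', -, c, hc, h, h1, h2⟩ := (h3 n G _).1 (h fun _ => ⟨0, hn⟩)
    refine ⟨⟨⟨h, fun {a b} hab => h2 a (Finset.mem_univ _) b (Finset.mem_univ _) hab⟩, ?_⟩⟩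
    intro a b hab
    refine (Finset.mem_filter.1 hc).2 ?_
    rw [← h1 a (Finset.mem_univ _), ← h1 b (Finset.mem_univ _)]
    have hab : h a = h b := hab
    rw [hab]
  · obtain ⟨f⟩ := h
    obtain ⟨y, hy, z, hz, hyz⟩ := exists_bitColor_injOn (K := K) hn
      (Finset.univ.image fun u => (f u : ℕ)) (by simp) (by
        have : (Finset.univ.image fun u => (f u : ℕ)).card ≤ Fintype.card V :=
          Finset.card_image_le
        exact Nat.mul_le_mul this this)
    refine (h3 n G v).2 ⟨Function.update (Function.update v (w + 1) ⟨y, hy⟩) (w + 2) ⟨z, hz⟩, ?_,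
      fun u => bitColor K y z (f u), ?_, f, ?_, ?_⟩
    · intro x hx
      simp only [Finset.mem_insert, Finset.mem_singleton, not_or] at hx
      rw [Function.update_of_ne hx.2, Function.update_of_ne hx.1]
    · refine Finset.mem_filter.2 ⟨Finset.mem_univ _, fun a b hab => ?_⟩
      exact f.injective' (Fin.ext (hyz (by simp) (by simp) hab))
    · intro u _
      beta_reduce
      rw [Function.update_self, Function.update_of_ne (by lia), Function.update_self]
    · exact fun u _ u' _ hu => f.toHom.map_adj hu

/-! ### A pure sentence with one variable per vertex -/

/-- The existence of an `F` subgraph is defined by a sentence without numerical relations. -/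
theorem exists_definesSubgraphOn {V : Type*} [Finite V] (F : SimpleGraph V)
    (C : ∀ n : ℕ, Set (SimpleGraph (Fin n))) :
    ∃ Φ : Formula (∅ : Set NumRel), DefinesSubgraphOn F C Φ := by
  classical
  obtain ⟨l, ⟨e⟩⟩ := Finite.exists_equiv_fin V
  -- The extra variable keeps `X` nonempty even for `l = 0`.
  let X := Finset.range (l + 1)
  have hX : X.Nonempty := ⟨0, by simp [X]⟩
  have hbody : Definable ∅ X X fun n G v =>
      ∀ i ∈ (Finset.univ : Finset (Fin l)), ∀ j ∈ (Finset.univ : Finset (Fin l)),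
        (i ≠ j → ¬ v i = v j) ∧ (F.Adj (e.symm i) (e.symm j) → G.Adj (v i) (v j)) := by
    have hm : ∀ i : Fin l, (i : ℕ) ∈ X := fun i => Finset.mem_range.2 (by lia)
    have hs : ∀ i j : Fin l, ({(i : ℕ), (j : ℕ)} : Finset ℕ) ⊆ X := fun i j => by
      simp [Finset.insert_subset_iff, hm]
    exact .all hX _ fun i _ => .all hX _ fun j _ =>
      (Definable.imp_const hX fun _ => ((Definable.eq (hm i) (hm j)).mono (hs i j)).not).and
        (.imp_const hX fun _ => (Definable.adj (hm i) (hm j)).mono (hs i j))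
  obtain ⟨Φ, -, h2, h3⟩ := hbody.exs (Z := X) subset_rfl
  refine ⟨Φ, by simpa [Formula.IsSentence] using h2, fun n hn G _ => ⟨fun h => ?_, fun h v => ?_⟩⟩
  · obtain ⟨v', -, h⟩ := (h3 n G _).1 (h fun _ => ⟨0, hn⟩)
    refine ⟨⟨⟨fun u => v' (e u), fun {a b} hab => ?_⟩, fun a b hab => ?_⟩⟩
    · exact (h (e a) (Finset.mem_univ _) (e b) (Finset.mem_univ _)).2 (by simpa using hab)
    · by_contra hne
      exact (h (e a) (Finset.mem_univ _) (e b) (Finset.mem_univ _)).1 (by simpa using hne) hab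
  · obtain ⟨f⟩ := h
    let v' : ℕ → Fin n := fun x => if hx : x < l then f (e.symm ⟨x, hx⟩) else v x
    have hv' : ∀ i : Fin l, v' i = f (e.symm i) := fun i => by simp [v']
    refine (h3 n G v).2 ⟨v', fun x hx => ?_, fun i _ j _ => ⟨fun hne => ?_, fun ha => ?_⟩⟩
    · simp only [X, Finset.mem_range] at hx
      simp only [v']
      rw [dif_neg (by lia)]
    · rw [hv', hv']
      exact fun h => hne (e.symm.injective (f.injective' h))
    · rw [hv', hv']
      exact f.toHom.map_adj ha

/-! ### The pebble game on attached cliques -/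

/-- The graph `M` with a clique of `e` new vertices attached at the vertex `q`. -/
def cliqueAt {A : Type*} (M : SimpleGraph A) (q : A) (e : ℕ) : SimpleGraph (A ⊕ Fin e) where
  Adj
    | .inl p, .inl p' => M.Adj p p'
    | .inl p, .inr _ => p = q
    | .inr _, .inl p => p = q
    | .inr i, .inr j => i ≠ j
  symm := ⟨by
    rintro (p | i) (p' | j) h
    · exact M.adj_symm h
    · exact h
    · exact h
    · exact Ne.symm h⟩
  loopless := ⟨by
    rintro (p | i) h
    · exact M.irrefl h
    · exact h rfl⟩

/-- The position in the pebble game on `cliqueAt M q a` and `cliqueAt M q b` is a win of the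
duplicator: pebbles in `M` agree and the new vertices show the same equalities. -/
def Matching {A : Type*} {a b : ℕ} (X : Finset ℕ) (u : ℕ → A ⊕ Fin a) (v : ℕ → A ⊕ Fin b) : Prop :=
  (∀ x ∈ X, ∀ p, u x = .inl p ↔ v x = .inl p) ∧ ∀ x ∈ X, ∀ y ∈ X, u x = u y ↔ v x = v y

namespace Matching

variable {A : Type*} {a b : ℕ} {X : Finset ℕ} {u : ℕ → A ⊕ Fin a} {v : ℕ → A ⊕ Fin b}

theorem symm (h : Matching X u v) : Matching X v u :=
  ⟨fun x hx p => (h.1 x hx p).symm, fun x hx y hy => (h.2 x hx y hy).symm⟩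

/-- Adjacency depends only on the vertices of `M` involved and on equality between new vertices. -/
theorem adj_iff (h : Matching X u v) (M : SimpleGraph A) (q : A) {x y : ℕ} (hx : x ∈ X)
    (hy : y ∈ X) : (cliqueAt M q a).Adj (u x) (u y) ↔ (cliqueAt M q b).Adj (v x) (v y) := by
  have h1 := h.1 x hx
  have h2 := h.1 y hy
  have h3 := h.2 x hx y hy
  generalize u x = u1 at *
  generalize v x = v1 at *
  generalize u y = u2 at *
  generalize v y = v2 at *
  rcases u1 with p | i <;> rcases v1 with p' | i' <;> rcases u2 with r | j <;>
    rcases v2 with r' | j' <;> simp_all [cliqueAt]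

/-- The duplicator copies a vertex of `M` and follows an already pebbled new vertex. A fresh new
vertex is answered by a fresh one: the other pebbles number at most `b - 1`, so one is free. -/
theorem exists_update (h : Matching X u v) (hb : X.card ≤ b) {x : ℕ} (hx : x ∈ X)
    (c : A ⊕ Fin a) : ∃ d, Matching X (Function.update u x c) (Function.update v x d) := by
  classical
  suffices hd : ∃ d : A ⊕ Fin b, (∀ p, c = .inl p ↔ d = .inl p) ∧
      ∀ y ∈ X, y ≠ x → (c = u y ↔ d = v y) by
    obtain ⟨d, hd1, hd2⟩ := hd
    refine ⟨d, fun t ht p => ?_, fun t ht t' ht' => ?_⟩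
    · by_cases htx : t = x
      · subst htx; simpa using hd1 p
      · simpa [htx] using h.1 t ht p
    · by_cases htx : t = x <;> by_cases htx' : t' = x
      · subst htx; subst htx'; simp
      · subst htx; simpa [htx'] using hd2 t' ht' htx'
      · subst htx'; simpa [htx, eq_comm] using hd2 t ht htx
      · simpa [htx, htx'] using h.2 t ht t' ht'
  rcases c with p | i
  · exact ⟨.inl p, fun p' => by simp, fun y hy _ => by
      rw [eq_comm, h.1 y hy p, eq_comm]⟩
  by_cases hy : ∃ y ∈ X, y ≠ x ∧ u y = .inr i
  · obtain ⟨y, hy, -, hyi⟩ := hy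
    refine ⟨v y, fun p => ?_, fun t ht _ => ?_⟩
    · rw [← hyi]; exact h.1 y hy p
    · rw [← hyi]; exact h.2 y hy t ht
  push Not at hy
  obtain ⟨j, hj⟩ : ∃ j : Fin b, ∀ y ∈ X.erase x, v y ≠ .inr j := by
    by_contra! hall
    choose y hy hyj using hall
    have := Finset.card_le_card_of_injOn (s := Finset.univ) (t := X.erase x) y
      (fun j _ => hy j) (fun j _ j' _ hjj => by
        have := hyj j
        rw [hjj, hyj j'] at this
        simpa using this.symm)
    rw [Finset.card_erase_of_mem hx] at this
    have hpos := Finset.card_pos.2 ⟨x, hx⟩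
    simp only [Finset.card_univ, Fintype.card_fin] at this
    lia
  refine ⟨.inr j, fun p => by simp, fun t ht htx => ?_⟩
  exact iff_of_false (fun h' => hy t ht htx h'.symm)
    (fun h' => hj t (Finset.mem_erase.2 ⟨htx, ht⟩) h'.symm)

end Matching

/-- Formulas with at most `w` variables do not count more than `w` new vertices. -/
theorem holds_iff_of_matching {A : Type*} (M : SimpleGraph A) (q : A) {a b m n : ℕ}
    {X : Finset ℕ} (ha : X.card ≤ a) (hb : X.card ≤ b) (e : Fin m ≃ A ⊕ Fin a)
    (f : Fin n ≃ A ⊕ Fin b) (φ : Formula ∅) (hφ : φ.vars ⊆ X) :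
    ∀ (u : ℕ → Fin m) (v : ℕ → Fin n), Matching X (e ∘ u) (f ∘ v) →
      (φ.Holds ((cliqueAt M q a).comap e) u ↔ φ.Holds ((cliqueAt M q b).comap f) v) := by
  induction φ with
  | eq x y =>
    intro u v h
    have := h.2 x (hφ (by simp [Formula.vars])) y (hφ (by simp [Formula.vars]))
    simpa [Formula.Holds] using this
  | adj x y =>
    intro u v h
    exact h.adj_iff M q (hφ (by simp [Formula.vars])) (hφ (by simp [Formula.vars]))
  | num R hR => exact absurd hR (Set.notMem_empty R)
  | neg φ ih => exact fun u v h => not_congr (ih hφ u v h)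
  | and φ ψ ih ih' =>
    exact fun u v h => and_congr (ih (Finset.union_subset_left hφ) u v h)
      (ih' (Finset.union_subset_right hφ) u v h)
  | ex x φ ih =>
    intro u v h
    obtain ⟨hx, hφ⟩ := Finset.insert_subset_iff.1 hφ
    constructor
    · rintro ⟨c, hc⟩
      obtain ⟨d, hd⟩ := h.exists_update hb hx (e c)
      refine ⟨f.symm d, (ih hφ _ _ ?_).1 hc⟩
      rwa [Function.comp_update, Function.comp_update, f.apply_symm_apply]
    · rintro ⟨d, hd⟩
      obtain ⟨c, hc⟩ := h.symm.exists_update ha hx (f d)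
      refine ⟨e.symm c, (ih hφ _ _ ?_).2 hd⟩
      rw [Function.comp_update, Function.comp_update, e.apply_symm_apply]
      exact hc.symm

/-! ### Linked paths: connectedness and treewidth -/

/-- `m` paths with `m * L` vertices each, where the `i`-th and the `j`-th are joined by an edge
between the vertex `L * j` of the former and the vertex `L * i` of the latter. -/
def linkedPaths (m L : ℕ) : SimpleGraph (Fin m × Fin (m * L)) where
  Adj p r := (p.1 = r.1 ∧ ((p.2 : ℕ) + 1 = r.2 ∨ (r.2 : ℕ) + 1 = p.2)) ∨
    (p.1 ≠ r.1 ∧ (p.2 : ℕ) = L * r.1 ∧ (r.2 : ℕ) = L * p.1)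
  symm := ⟨fun p r h => by
    rcases h with ⟨h1, h2⟩ | ⟨h1, h2, h3⟩
    · exact .inl ⟨h1.symm, h2.symm⟩
    · exact .inr ⟨h1.symm, h3, h2⟩⟩
  loopless := ⟨fun p h => by
    rcases h with ⟨-, h⟩ | ⟨h, -⟩
    · lia
    · exact h rfl⟩

theorem linkedPaths_reachable_fst {m L : ℕ} (i : Fin m) (k : ℕ) :
    ∀ (hk : k < m * L) (b : Fin (m * L)), (b : ℕ) = 0 → (linkedPaths m L).Reachable (i, b) (i, ⟨k, hk⟩) := by
  induction k with
  | zero =>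
    intro hk b hb
    rw [show b = ⟨0, hk⟩ from Fin.ext hb]
  | succ k ih =>
    intro hk b hb
    refine (ih (by lia) b hb).trans (SimpleGraph.Adj.reachable ?_)
    exact .inl ⟨rfl, .inl rfl⟩

theorem mul_val_lt {m L : ℕ} (hL : 0 < L) (i : Fin m) : L * (i : ℕ) < m * L := by
  rw [mul_comm]
  exact Nat.mul_lt_mul_of_pos_right i.2 hL

theorem linkedPaths_connected {m L : ℕ} (hm : 0 < m) (hL : 0 < L) :
    (linkedPaths m L).Connected := by
  have h0 : 0 < m * L := Nat.mul_pos hm hL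
  have hrow : ∀ (i : Fin m) (b : Fin (m * L)),
      (linkedPaths m L).Reachable (i, ⟨0, h0⟩) (i, b) :=
    fun i b => linkedPaths_reachable_fst i b b.2 _ rfl
  -- Position `L * i` of path 0 is joined to position 0 of path `i`.
  have hroot : ∀ i : Fin m, (linkedPaths m L).Reachable (⟨0, hm⟩, ⟨0, h0⟩) (i, ⟨0, h0⟩) := by
    intro i
    by_cases hi : i = ⟨0, hm⟩
    · rw [hi]
    · refine (hrow _ ⟨L * i, mul_val_lt hL i⟩).trans (SimpleGraph.Adj.reachable ?_)
      exact .inr ⟨fun h => hi h.symm, rfl, by simp⟩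
  rw [SimpleGraph.connected_iff_exists_forall_reachable]
  exact ⟨_, fun p => (hroot p.1).trans (hrow p.1 p.2)⟩

theorem cliqueAt_connected {A : Type*} {M : SimpleGraph A} (hM : M.Connected) (q : A) (e : ℕ) :
    (cliqueAt M q e).Connected := by
  rw [SimpleGraph.connected_iff_exists_forall_reachable]
  refine ⟨.inl q, ?_⟩
  rintro (p | i)
  · exact (hM.preconnected q p).map (⟨Sum.inl, fun h => h⟩ : M →g cliqueAt M q e)
  · exact SimpleGraph.Adj.reachable (show q = q from rfl)

/-- The `k + 1` disjoint, pairwise adjacent paths force a bag that meets all of them. -/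
theorem le_treewidth_of_linkedPaths {V : Type*} [Fintype V] (G : SimpleGraph V) {k L : ℕ}
    (hL : 0 < L) (f : (linkedPaths (k + 1) L).Copy G) : k ≤ treewidth G := by
  refine le_treewidth G k fun D => ?_
  have h0 : 0 < (k + 1) * L := Nat.mul_pos (by lia) hL
  refine D.exists_card_le_bag (k := (k + 1) * L - 1)
    -- The minimum only makes the path total in its index.
    (fun i a => f (i, ⟨min a ((k + 1) * L - 1), by lia⟩)) ?_ ?_ ?_
  · intro i a ha
    refine f.toHom.map_adj (.inl ⟨rfl, .inl ?_⟩)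
    simp only
    lia
  · intro i j a _ b _ h
    exact (Prod.ext_iff.1 (f.injective' h)).1
  · intro i j hij
    have hi := mul_val_lt hL i
    have hj := mul_val_lt hL j
    refine ⟨L * j, by lia, L * i, by lia, f.toHom.map_adj (.inr ⟨hij, ?_, ?_⟩)⟩ <;>
      simp only <;> lia

/-! ### Small subgraphs of the host are prunable -/

theorem prunable_of_forall {V : Type*} [DecidableEq V] {F : SimpleGraph V} {w : ℕ}
    (h : ∀ S : Finset V, w + 1 < S.card → ∃ v ∈ S, ∃ u, ∀ x ∈ S, F.Adj v x → x = u)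
    (S : Finset V) : Prunable F w S := by
  induction S using Finset.strongInduction with
  | H S ih =>
    by_cases hS : S.card ≤ w + 1
    · exact .small S hS
    · obtain ⟨v, hv, u, hu⟩ := h S (not_le.1 hS)
      exact .prune S v u hv hu (ih _ (Finset.erase_ssubset hv))

/-- Small subgraphs of long linked paths with a `(w + 1)`-clique at the corner are prunable. -/
theorem prunable_of_copy {V : Type*} [Fintype V] [DecidableEq V] {F : SimpleGraph V}
    {m L w : ℕ} (hL : Fintype.card V ≤ L) (hL2 : 2 ≤ L) (q : Fin m × Fin (m * L))
    (hq1 : (q.1 : ℕ) = 0) (hq2 : (q.2 : ℕ) = 0)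
    (f : F.Copy (cliqueAt (linkedPaths m L) q w)) : Prunable F w Finset.univ := by
  refine prunable_of_forall (fun S hS => ?_) _
  by_contra! hmin
  have hf := f.injective'
  have hadj : ∀ {x y}, F.Adj x y → (cliqueAt (linkedPaths m L) q w).Adj (f x) (f y) :=
    fun h => f.toHom.map_adj h
  have htwo : ∀ v ∈ S, ∃ x ∈ S, ∃ y ∈ S, F.Adj v x ∧ F.Adj v y ∧ x ≠ y := by
    intro v hv
    obtain ⟨x, hx, hvx, -⟩ := hmin v hv v
    obtain ⟨y, hy, hvy, hxy⟩ := hmin v hv x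
    exact ⟨x, hx, y, hy, hvx, hvy, hxy.symm⟩
  have hnb : ∀ i b, (i, b) ≠ q → ∀ v x, f v = .inl (i, b) → F.Adj v x →
      ∃ p, f x = .inl p ∧ (linkedPaths m L).Adj (i, b) p := by
    intro i b hne v x hv hvx
    have h := hadj hvx
    rw [hv] at h
    cases hx : f x with
    | inl p => rw [hx] at h; exact ⟨p, rfl, h⟩
    | inr j => rw [hx] at h; exact absurd h hne
  -- Strictly between multiples of `L` the only neighbours are the two along the path, and minimum
  -- degree two forces both into the image of `S`.
  have hstep : ∀ (i : Fin m) (c r : ℕ), 0 < r → r < L →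
      (∃ x ∈ S, ∃ b : Fin (m * L), (b : ℕ) = L * c + r ∧ f x = .inl (i, b)) →
      (∃ x ∈ S, ∃ b : Fin (m * L), (b : ℕ) = L * c + (r + 1) ∧ f x = .inl (i, b)) ∧
      (∃ x ∈ S, ∃ b : Fin (m * L), (b : ℕ) = L * c + (r - 1) ∧ f x = .inl (i, b)) := by
    rintro i c r hr hrL ⟨v, hv, b, hb, hvb⟩
    have hnd : ∀ d, (b : ℕ) ≠ L * d := by
      intro d hd
      have h1 : (L * c + r) % L = r := by rw [Nat.mul_add_mod, Nat.mod_eq_of_lt hrL]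
      rw [← hb, hd, Nat.mul_mod_right] at h1
      lia
    have hne : (i, b) ≠ q := by
      rintro rfl
      exact hnd 0 (by simpa using hq2)
    have key : ∀ x, F.Adj v x → ∃ d : Fin (m * L), f x = .inl (i, d) ∧
        ((b : ℕ) + 1 = d ∨ (d : ℕ) + 1 = b) := by
      intro x hvx
      obtain ⟨⟨i', d⟩, hx, h⟩ := hnb i b hne v x hvb hvx
      rcases h with ⟨h1, h2⟩ | ⟨-, h2, -⟩
      · obtain rfl : i = i' := h1
        exact ⟨d, hx, h2⟩
      · exact absurd h2 (hnd _)
    obtain ⟨x, hx, y, hy, hvx, hvy, hxy⟩ := htwo v hv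
    obtain ⟨d, hxd, hd⟩ := key x hvx
    obtain ⟨d', hyd, hd'⟩ := key y hvy
    have hdd : (d : ℕ) ≠ d' := by
      intro h
      rw [Fin.ext h, ← hyd] at hxd
      exact hxy (hf hxd)
    rcases hd with hd | hd <;> rcases hd' with hd' | hd'
    · lia
    · exact ⟨⟨x, hx, d, by lia, hxd⟩, ⟨y, hy, d', by lia, hyd⟩⟩
    · exact ⟨⟨y, hy, d', by lia, hyd⟩, ⟨x, hx, d, by lia, hxd⟩⟩
    · lia
  -- Otherwise the image spreads both ways over a whole segment, whose `L + 1` vertices are more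
  -- than `F` has.
  have hmul : ∀ v ∈ S, ∀ i b, f v = .inl (i, b) → L ∣ (b : ℕ) := by
    intro v hv i b hvb
    by_contra hnd
    obtain ⟨c, r, hb, hr, hrL⟩ : ∃ c r, (b : ℕ) = L * c + r ∧ 0 < r ∧ r < L :=
      ⟨_, _, (Nat.div_add_mod _ L).symm,
        Nat.pos_of_ne_zero fun h => hnd (Nat.dvd_of_mod_eq_zero h), Nat.mod_lt _ (by lia)⟩
    clear hnd
    let R : ℕ → Prop := fun t =>
      ∃ x ∈ S, ∃ d : Fin (m * L), (d : ℕ) = L * c + t ∧ f x = .inl (i, d)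
    have h0 : R r := ⟨v, hv, b, hb, hvb⟩
    have hup : ∀ s, r + s ≤ L → R (r + s) := by
      intro s
      induction s with
      | zero => exact fun _ => h0
      | succ s ih => exact fun hs => (hstep i c _ (by lia) (by lia) (ih (by lia))).1
    have hdown : ∀ s, s ≤ r → R (r - s) := by
      intro s
      induction s with
      | zero => exact fun _ => h0
      | succ s ih =>
        intro hs
        have := (hstep i c _ (by lia) (by lia) (ih (by lia))).2
        rwa [Nat.sub_sub] at this
    have hall : ∀ t : Fin (L + 1), R t := by
      intro t
      rcases le_total (t : ℕ) r with h | h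
      · have := hdown (r - t) (by lia)
        rwa [Nat.sub_sub_self h] at this
      · have := hup (t - r) (by lia)
        rwa [Nat.add_sub_cancel' h] at this
    choose x hx d hd hxd using hall
    have hinj : Function.Injective x := by
      intro r r' h
      have h1 := hxd r
      rw [h, hxd r'] at h1
      simp only [Sum.inl.injEq, Prod.mk.injEq, true_and] at h1
      have := hd r
      rw [← h1, hd r'] at this
      exact Fin.ext (by lia)
    have := Fintype.card_le_of_injective x hinj
    rw [Fintype.card_fin] at this
    lia
  -- As `2 ≤ L`, multiples of `L` are never consecutive. Only a cross edge remains, and its other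
  -- end is determined by `(i, b)`, so a second neighbour is impossible away from `q`.
  have hroot : ∀ v ∈ S, ∀ p, f v = .inl p → p = q := by
    rintro v hv ⟨i, b⟩ hvb
    by_contra hne
    have hb := hmul v hv i b hvb
    have key : ∀ x ∈ S, F.Adj v x → ∃ i' d, f x = .inl (i', d) ∧ (b : ℕ) = L * i' ∧
        (d : ℕ) = L * i := by
      intro x hx hvx
      obtain ⟨⟨i', d⟩, hxd, h⟩ := hnb i b hne v x hvb hvx
      have hd := hmul x hx _ _ hxd
      rcases h with ⟨-, h | h⟩ | ⟨-, h⟩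
      · simp only at h
        rw [← h, Nat.dvd_add_right hb, Nat.dvd_one] at hd
        lia
      · simp only at h
        rw [← h, Nat.dvd_add_right hd, Nat.dvd_one] at hb
        lia
      · exact ⟨i', d, hxd, h⟩
    obtain ⟨x, hx, y, hy, hvx, hvy, hxy⟩ := htwo v hv
    obtain ⟨i1, d1, hx1, h1, h1'⟩ := key x hx hvx
    obtain ⟨i2, d2, hx2, h2, h2'⟩ := key y hy hvy
    have hi : i1 = i2 := Fin.ext (Nat.eq_of_mul_eq_mul_left (by lia) (h1.symm.trans h2))
    have hd : d1 = d2 := Fin.ext (h1'.trans h2'.symm)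
    subst hi; subst hd
    exact hxy (hf (hx1.trans hx2.symm))
  have hcard := Finset.card_le_card_of_injOn (s := S)
    (t := insert (.inl q) (Finset.univ.image (Sum.inr : Fin w → _))) f (by
      intro v hv
      cases h : f v with
      | inl p => simp [hroot v hv p h]
      | inr j => simp) hf.injOn
  have h1 := Finset.card_insert_le (.inl q) (Finset.univ.image
    (Sum.inr : Fin w → (Fin m × Fin (m * L)) ⊕ Fin w))
  have h2 : (Finset.univ.image (Sum.inr : Fin w → (Fin m × Fin (m * L)) ⊕ Fin w)).card ≤ w :=
    Finset.card_image_le.trans (by simp)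
  lia

/-- This gives positive width, hence the second vertex variable needed for pruning. -/
theorem Formula.vars_nonempty {N : Set NumRel} (φ : Formula N) : φ.vars.Nonempty := by
  induction φ with
  | eq x y => exact ⟨x, by simp [vars]⟩
  | adj x y => exact ⟨x, by simp [vars]⟩
  | num R hR x => exact ⟨x 0, by simp [vars]⟩
  | neg φ ih => exact ih
  | and φ ψ ih _ => exact ih.mono Finset.subset_union_left
  | ex x φ _ => exact ⟨x, Finset.mem_insert_self _ _⟩

/-- A pattern graph that is definable with `w` variables on connected graphs of large treewidth
is prunable to `w + 1` vertices. -/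
theorem prunable_of_definesSubgraphOn {V : Type*} [Fintype V] [DecidableEq V] {F : SimpleGraph V}
    {Φ : Formula (∅ : Set NumRel)} {k : ℕ}
    (hΦ : DefinesSubgraphOn F (fun _ => {G | G.Connected ∧ k ≤ treewidth G}) Φ) :
    Prunable F Φ.width Finset.univ := by
  -- This ensures both `Fintype.card V ≤ L` and `2 ≤ L`.
  let L := Fintype.card V + 2
  have h0 : 0 < (k + 1) * L := Nat.mul_pos (by lia) (by simp [L])
  let M := linkedPaths (k + 1) L
  let q : Fin (k + 1) × Fin ((k + 1) * L) := (0, ⟨0, h0⟩)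
  have hM : M.Connected := linkedPaths_connected (by lia) (by simp [L])
  have hmodels : ∀ a n (e : Fin n ≃ (Fin (k + 1) × Fin ((k + 1) * L)) ⊕ Fin a),
      Φ.Models ((cliqueAt M q a).comap e) ↔ F.IsContained ((cliqueAt M q a).comap e) := by
    intro a n e
    have g : (cliqueAt M q a).comap e ≃g cliqueAt M q a := SimpleGraph.Iso.comap e _
    refine hΦ.2 n (Fin.pos (e.symm (.inl q))) _ ⟨?_, ?_⟩
    · exact g.connected_iff.2 (cliqueAt_connected hM q a)
    · refine le_treewidth_of_linkedPaths _ (L := L) (by simp [L]) (g.symm.toCopy.comp ?_)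
      exact ⟨⟨Sum.inl, fun h => h⟩, Sum.inl_injective⟩
  let w := Φ.width
  -- Large enough for the game (`w ≤ a`), and its last `Fintype.card V` clique vertices hold a copy
  -- of `F`.
  let a := w + Fintype.card V
  let e := (Fintype.equivFin ((Fin (k + 1) × Fin ((k + 1) * L)) ⊕ Fin w)).symm
  let e' := (Fintype.equivFin ((Fin (k + 1) × Fin ((k + 1) * L)) ⊕ Fin a)).symm
  have hlarge : F.IsContained ((cliqueAt M q a).comap e') := by
    have hF : F.IsContained (cliqueAt M q a) := by
      refine ⟨⟨fun u => .inr (Fin.natAdd w (Fintype.equivFin V u)), fun {x y} h => ?_⟩, ?_⟩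
      · intro h'
        have h' : Fin.natAdd w (Fintype.equivFin V x) = Fin.natAdd w (Fintype.equivFin V y) := h'
        exact h.ne (by simpa using h')
      · intro x y h
        have h : Fin.natAdd w (Fintype.equivFin V x) = Fin.natAdd w (Fintype.equivFin V y) :=
          Sum.inr_injective h
        simpa using h
    exact hF.trans ⟨(SimpleGraph.Iso.comap e' (cliqueAt M q a)).symm.toCopy⟩
  have hsmall : F.IsContained ((cliqueAt M q w).comap e) := by
    rw [← hmodels]
    intro u
    -- Transporting an assignment along the inclusion of the smaller graph gives a matching initial
    -- position.
    obtain ⟨g, hg, hgl⟩ : ∃ g : (Fin (k + 1) × Fin ((k + 1) * L)) ⊕ Fin w →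
        (Fin (k + 1) × Fin ((k + 1) * L)) ⊕ Fin a,
        Function.Injective g ∧ ∀ p, g (.inl p) = .inl p :=
      ⟨Sum.map id (Fin.castAdd _), Function.injective_id.sumMap (Fin.castAdd_injective _ _),
        fun _ => rfl⟩
    refine (holds_iff_of_matching M q (a := w) (b := a) le_rfl (Nat.le_add_right _ _) e e' Φ
      subset_rfl u
      (fun x => e'.symm (g (e (u x)))) ⟨fun x _ p => ?_, fun x _ y _ => ?_⟩).2
        ((hmodels a _ e').2 hlarge _)
    · simp only [Function.comp_apply, Equiv.apply_symm_apply]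
      rw [← hgl p, hg.eq_iff]
    · simp only [Function.comp_apply, Equiv.apply_symm_apply]
      exact hg.eq_iff.symm
  obtain ⟨f⟩ := hsmall.trans ⟨(SimpleGraph.Iso.comap e (cliqueAt M q w)).toCopy⟩
  exact prunable_of_copy (by simp [L]) (by simp [L]) q rfl rfl f

end SubgraphLogic

theorem corollary4p3 {V : Type*} [Finite V] (F : SimpleGraph V) (hF : F.Connected) :
    SubgraphLogic.Wtw F ≠ ⊤ ∧ SubgraphLogic.WArb F ≤ SubgraphLogic.Wtw F + 3 := by
  open SubgraphLogic in
  classical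
  have := Fintype.ofFinite V
  constructor
  · obtain ⟨Φ, hΦ⟩ := exists_definesSubgraphOn F fun _ => {G | G.Connected ∧ 0 ≤ treewidth G}
    exact ((iInf₂_le Φ ⟨0, hΦ⟩).trans_lt (ENat.natCast_lt_top _)).ne
  · rw [Wtw, minWidth, ENat.iInf_add]
    refine le_iInf fun Φ => ?_
    rw [ENat.iInf_add]
    refine le_iInf fun ⟨k, hΦ⟩ => ?_
    obtain ⟨Ψ, hΨ, hw⟩ := (prunable_of_definesSubgraphOn hΦ).exists_definesSubgraphOn
      (Finset.card_pos.2 Φ.vars_nonempty)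
    exact (iInf₂_le Ψ hΨ).trans (by exact_mod_cast hw)
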